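/- Let $\mathbb{K}$ be $\mathbb{R}$ or $\mathbb{C}$, let $\mathbb{N}=\{1,2,3,\dots\}$, and let $X$ be either $\ell^p(\mathbb{N})$ for some $1\le p<\infty$ or $c_0(\mathbb{N})$ (scalars in $\mathbb{K}$, usual norms). Let $w=(w_j)_{j\in\mathbb{N}}$ be a bounded sequence of non-zero scalars in $\mathbb{K}$, and let $B_w\colon X\to X$, $B_w(x_1,x_2,\dots)=(w_2x_2,w_3x_3,\dots)$, be the associated unilateral backward weighted shift. Then the following conditions are equivalent: 1. $\displaystyle\sup_{k,n\in\mathbb{N}}\ \prod_{j=k+1}^{n+k+1}|w_j|=\infty$; 2. there exists a Li-Yorke scrambled pair for $B_w$; 3. $B_w$ is Li-Yorke chaotic; 4. $B_w$ admits a dense irregular manifold; 5. $B_w$ is densely uniformly Li-Yorke chaotic. Here a pair $(x,y)\in X\times X$ is *Li-Yorke scrambled* if $\liminf_{n\to\infty}\|B_w^nx-B_w^ny\|=0$ and $\limsup_{n\to\infty}\|B_w^nx-B_w^ny\|>0$ (possibly $\infty$). A set $S\subseteq X$ with at least two points is *Li-Yorke scrambled* if every pair of distinct points of $S$ is Li-Yorke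 scrambled, and $B_w$ is *Li-Yorke chaotic* if there is an uncountable Li-Yorke scrambled set. A vector $x$ is *irregular* if $\liminf_{n\to\infty}\|B_w^nx\|=0$ and $\limsup_{n\to\infty}\|B_w^nx\|=\infty$; an *irregular manifold* is a vector subspace $Y\subseteq X$ (not necessarily closed) every non-zero vector of which is irregular. A set $S\subseteq X$ with at least two points is *uniformly Li-Yorke scrambled* if there are two sequences $(p_n)$, $(q_n)$ of non-negative integers such that for all distinct $x,y\in S$, $\lim_{n\to\infty}\|B_w^{p_n}x-B_w^{p_n}y\|=0$ and $\lim_{n\to\infty}\|B_w^{q_n}x-B_w^{q_n}y\|=\infty$; and $B_w$ is *densely uniformly Li-Yorke chaotic* if there is a dense, uncountable, uniformly Li-Yorke scrambled subset of $X$. -/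

import Mathlib

open Filter Topology
open scoped ENNReal ZeroAtInfty

/-! Li-Yorke chaos for self-maps of a metric space -/

section Chaos

variable {X : Type*} [MetricSpace X]

/-- `(x, y)` is a Li-Yorke scrambled pair for `f`. The distance is taken with values in `[0, ∞]`,
so that the lower and upper limits always exist. -/
def IsLiYorkePair (f : X → X) (x y : X) : Prop :=
  liminf (fun n : ℕ => edist (f^[n] x) (f^[n] y)) atTop = 0 ∧
    0 < limsup (fun n : ℕ => edist (f^[n] x) (f^[n] y)) atTop

/-- A set with at least two points, any two distinct points of which form a scrambled pair. -/
def IsLiYorkeScrambled (f : X → X) (S : Set X) : Prop :=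
  S.Nontrivial ∧ ∀ x ∈ S, ∀ y ∈ S, x ≠ y → IsLiYorkePair f x y

/-- `f` has an uncountable Li-Yorke scrambled set. -/
def IsLiYorkeChaotic (f : X → X) : Prop :=
  ∃ S : Set X, ¬ S.Countable ∧ IsLiYorkeScrambled f S

/-- A set with at least two points, all of whose pairs of distinct points are
asymptotic along one common sequence of times and infinitely separated along another. -/
def IsUniformlyLiYorkeScrambled (f : X → X) (S : Set X) : Prop :=
  S.Nontrivial ∧ ∃ p q : ℕ → ℕ, ∀ x ∈ S, ∀ y ∈ S, x ≠ y →
    Tendsto (fun n => dist (f^[p n] x) (f^[p n] y)) atTop (𝓝 0) ∧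
    Tendsto (fun n => dist (f^[q n] x) (f^[q n] y)) atTop atTop

/-- `f` has a dense uncountable uniformly Li-Yorke scrambled set. -/
def IsDenselyUniformlyLiYorkeChaotic (f : X → X) : Prop :=
  ∃ S : Set X, Dense S ∧ ¬ S.Countable ∧ IsUniformlyLiYorkeScrambled f S

end Chaos

/-! Irregular vectors and irregular manifolds of a bounded operator -/

section Irregular

variable {𝕜 X : Type*} [RCLike 𝕜] [NormedAddCommGroup X] [NormedSpace 𝕜 X]

/-- `x` is irregular for `T`: `liminf ‖Tⁿ x‖ = 0` and `limsup ‖Tⁿ x‖ = ∞`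
(norms with values in `[0, ∞]`). -/
def IsIrregularVector (T : X →L[𝕜] X) (x : X) : Prop :=
  liminf (fun n : ℕ => ‖(T ^ n) x‖ₑ) atTop = 0 ∧
    limsup (fun n : ℕ => ‖(T ^ n) x‖ₑ) atTop = ∞

/-- A vector subspace all of whose non-zero vectors are irregular for `T`. -/
def IsIrregularManifold (T : X →L[𝕜] X) (Y : Submodule 𝕜 X) : Prop :=
  ∀ y ∈ Y, y ≠ 0 → IsIrregularVector T y

end Irregular

/-! Unilateral backward weighted shifts, with coordinates indexed by `1, 2, 3, …` -/

section Shift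

variable {𝕜 : Type*} [RCLike 𝕜]

/-- `(x₁, x₂, …) ↦ (w₂ x₂, w₃ x₃, …)` on all sequences. -/
def shiftSeq (w x : ℕ+ → 𝕜) : ℕ+ → 𝕜 := fun i => w (i + 1) * x (i + 1)

theorem exists_weight_bound {w : ℕ+ → 𝕜} (hw : BddAbove (Set.range fun j => ‖w j‖)) :
    ∃ C : ℝ, 0 ≤ C ∧ ∀ j, ‖w j‖ ≤ C := by
  obtain ⟨C, hC⟩ := hw
  have h : ∀ j, ‖w j‖ ≤ C := fun j => hC ⟨j, rfl⟩
  exact ⟨C, (norm_nonneg _).trans (h 1), h⟩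

theorem norm_shiftSeq_le {w : ℕ+ → 𝕜} {C : ℝ} (hC : ∀ j, ‖w j‖ ≤ C) (x : ℕ+ → 𝕜) (i : ℕ+) :
    ‖shiftSeq w x i‖ ≤ C * ‖x (i + 1)‖ := by
  rw [shiftSeq, norm_mul]
  exact mul_le_mul_of_nonneg_right (hC _) (norm_nonneg _)

theorem memℓp_succ {p : ℝ≥0∞} {x : ℕ+ → 𝕜} (hx : Memℓp x p) :
    Memℓp (fun i : ℕ+ => x (i + 1)) p := by
  have hinj : Function.Injective (fun i : ℕ+ => i + 1) := add_left_injective 1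
  rcases p.trichotomy with (rfl | rfl | hp)
  · exact memℓp_zero (hx.finite_dsupport.preimage hinj.injOn)
  · refine memℓp_infty (hx.bddAbove.mono ?_)
    rintro _ ⟨i, rfl⟩
    exact ⟨i + 1, rfl⟩
  · exact memℓp_gen ((hx.summable hp).comp_injective hinj)

theorem memℓp_shiftSeq {p : ℝ≥0∞} {w : ℕ+ → 𝕜} (hw : BddAbove (Set.range fun j => ‖w j‖))
    {x : ℕ+ → 𝕜} (hx : Memℓp x p) : Memℓp (shiftSeq w x) p := by
  obtain ⟨C, -, hC⟩ := exists_weight_bound hw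
  refine ((memℓp_succ hx).norm.const_mul C).mono fun i => ?_
  exact norm_shiftSeq_le hC x i

theorem norm_lp_succ_le {p : ℝ≥0∞} [Fact (1 ≤ p)] (x : lp (fun _ : ℕ+ => 𝕜) p) :
    ‖(⟨fun i : ℕ+ => x (i + 1), memℓp_succ (lp.memℓp x)⟩ : lp (fun _ : ℕ+ => 𝕜) p)‖ ≤ ‖x‖ := by
  have hinj : Function.Injective (fun i : ℕ+ => i + 1) := add_left_injective 1
  rcases p.dichotomy with (rfl | hp)
  · exact lp.norm_le_of_forall_le (norm_nonneg _) fun i =>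
      lp.norm_apply_le_norm ENNReal.top_ne_zero x (i + 1)
  · have hp0 : 0 < p.toReal := zero_lt_one.trans_le hp
    refine lp.norm_le_of_tsum_le hp0 (norm_nonneg _) ?_
    rw [lp.norm_rpow_eq_tsum hp0 x]
    exact tsum_comp_le_tsum_of_inj ((lp.memℓp x).summable hp0)
      (fun i => Real.rpow_nonneg (norm_nonneg _) _) hinj

/-- The unilateral backward weighted shift `B_w` on `ℓ^p`, for a bounded weight sequence `w`. -/
noncomputable def shiftLp (p : ℝ≥0∞) [Fact (1 ≤ p)] (w : ℕ+ → 𝕜)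
    (hw : BddAbove (Set.range fun j => ‖w j‖)) :
    lp (fun _ : ℕ+ => 𝕜) p →L[𝕜] lp (fun _ : ℕ+ => 𝕜) p :=
  LinearMap.mkContinuousOfExistsBound
    { toFun := fun x => ⟨shiftSeq w x, memℓp_shiftSeq hw (lp.memℓp x)⟩
      map_add' := fun x y => by
        ext i
        exact mul_add _ _ _
      map_smul' := fun c x => by
        ext i
        simp [shiftSeq, mul_left_comm] }
    (by
      obtain ⟨C, hC0, hC⟩ := exists_weight_bound hw
      refine ⟨C, fun x => ?_⟩
      have hs := norm_lp_succ_le x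
      set y : lp (fun _ : ℕ+ => 𝕜) p := ⟨fun i : ℕ+ => x (i + 1), memℓp_succ (lp.memℓp x)⟩
      have hp : p ≠ 0 := (zero_lt_one.trans_le (Fact.out : 1 ≤ p)).ne'
      have h : ‖(⟨shiftSeq w x, memℓp_shiftSeq hw (lp.memℓp x)⟩ : lp (fun _ : ℕ+ => 𝕜) p)‖
          ≤ ‖(C : 𝕜) • y‖ := by
        refine lp.norm_mono hp fun i => ?_
        have := norm_shiftSeq_le hC x i
        simpa [y, norm_smul, abs_of_nonneg hC0] using this
      refine h.trans ((norm_smul_le _ _).trans ?_)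
      rw [RCLike.norm_ofReal, abs_of_nonneg hC0]
      exact mul_le_mul_of_nonneg_left hs hC0)

/-- The unilateral backward weighted shift `B_w` on `c₀`, for a bounded weight sequence `w`. Here
`c₀` is the space of functions on the discrete space `{1, 2, 3, …}` that vanish at infinity,
with the supremum norm. -/
noncomputable def shiftC0 (w : ℕ+ → 𝕜) (hw : BddAbove (Set.range fun j => ‖w j‖)) :
    C₀(ℕ+, 𝕜) →L[𝕜] C₀(ℕ+, 𝕜) :=
  LinearMap.mkContinuousOfExistsBound
    { toFun := fun x =>
        { toFun := shiftSeq w x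
          continuous_toFun := continuous_of_discreteTopology
          zero_at_infty' := by
            obtain ⟨C, -, hC⟩ := exists_weight_bound hw
            have hinj : Function.Injective (fun i : ℕ+ => i + 1) := add_left_injective 1
            have h := zero_at_infty x
            rw [cocompact_eq_cofinite] at h ⊢
            refine squeeze_zero_norm (norm_shiftSeq_le hC x) ?_
            simpa using (h.comp hinj.tendsto_cofinite).norm.const_mul C }
      map_add' := fun x y => by
        ext i
        simp [shiftSeq, mul_add]
      map_smul' := fun c x => by
        ext i
        simp [shiftSeq, mul_left_comm] }
    (by
      obtain ⟨C, hC0, hC⟩ := exists_weight_bound hw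
      refine ⟨C, fun x => ?_⟩
      rw [← ZeroAtInftyContinuousMap.norm_toBCF_eq_norm,
        ← ZeroAtInftyContinuousMap.norm_toBCF_eq_norm]
      refine (BoundedContinuousFunction.norm_le (by positivity)).2 fun i => ?_
      exact (norm_shiftSeq_le hC x i).trans
        (mul_le_mul_of_nonneg_left (x.toBCF.norm_coe_le_norm (i + 1)) hC0))

theorem shiftLp_apply (p : ℝ≥0∞) [Fact (1 ≤ p)] (w : ℕ+ → 𝕜)
    (hw : BddAbove (Set.range fun j => ‖w j‖)) (x : lp (fun _ : ℕ+ => 𝕜) p) (i : ℕ+) :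
    shiftLp p w hw x i = w (i + 1) * x (i + 1) := rfl

theorem shiftC0_apply (w : ℕ+ → 𝕜) (hw : BddAbove (Set.range fun j => ‖w j‖))
    (x : C₀(ℕ+, 𝕜)) (i : ℕ+) : shiftC0 w hw x i = w (i + 1) * x (i + 1) := rfl

end Shift

/-! Lower and upper limits of a sequence in `[0, ∞]` read off from a family of times -/

/-! If the weight products are bounded, the powers of the shift are uniformly bounded, so a
difference of orbits that once becomes small stays small and no scrambled pair exists
(`no_pair_of_powerBounded`).

If they are unbounded, `exists_spikes` gives sites `s 0 < s 1 < …` such that a huge product of `q k`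
weights ends at `s (k + 1)`. A polynomial `P` is sent to the sum of spikes `t k * P(t k)` at `s (k +
1)`, with `t k` tiny. At time `s j` the spikes with `k < j` have been shifted out and the others are
still negligible. At time `q k` the huge product acts on spike `k`; since a non-zero `P` vanishes at
`0` only to finite order, `P(t k)` is at least a power of `t k`, and the product beats every such
power. Adding a finitely supported part that meets each unit vector for infinitely many monomials
makes the range dense (`dense_range_unitMap_add_spikeMap`). Every non-zero vector of this range uses
the same two time sequences, which gives conditions 4 and 5 together. -/

theorem limsup_eq_top_of_tendsto_comp {f : ℕ → ℝ≥0∞} (hf : ∀ n, f n ≠ ∞) {q : ℕ → ℕ}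
    (hq : Tendsto (f ∘ q) atTop (𝓝 ∞)) : limsup f atTop = ∞ := by
  refine ENNReal.eq_top_of_forall_nnreal_le fun M => ?_
  refine le_limsup_of_frequently_le' fun hM => ?_
  obtain ⟨N, hN⟩ := eventually_atTop.1 hM
  have hlt : max (M : ℝ≥0∞) (∑ n ∈ Finset.range N, f n) < ∞ :=
    max_lt ENNReal.coe_lt_top (ENNReal.sum_lt_top.2 fun n _ => (hf n).lt_top)
  obtain ⟨n, hn⟩ := (hq.eventually (lt_mem_nhds hlt)).exists
  rcases lt_or_ge (q n) N with h | h
  · exact absurd (Finset.single_le_sum (f := f) (fun _ _ => zero_le) (Finset.mem_range.2 h))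
      (not_le.2 ((le_max_right _ _).trans_lt hn))
  · exact hN _ h ((le_max_left _ _).trans hn.le)

/-- The times `p` need not tend to infinity. Either `f` vanishes from some time on, or any finite
set of its values has a positive minimum, so small values must occur late. -/
theorem liminf_eq_zero_of_tendsto_comp {f : ℕ → ℝ≥0∞} (hf : ∀ n, f n = 0 → f (n + 1) = 0)
    {p : ℕ → ℕ} (hp : Tendsto (f ∘ p) atTop (𝓝 0)) : liminf f atTop = 0 := by
  have hzero : ∀ m, f m = 0 → ∀ n ≥ m, f n = 0 := fun m hm n hn =>
    Nat.le_induction hm (fun k _ hk => hf k hk) n hn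
  refine le_antisymm (le_of_forall_gt fun M hM => ?_) zero_le
  obtain ⟨M', hM'0, hM'⟩ := exists_between hM
  refine (liminf_le_of_frequently_le' (x := M') fun hfr => ?_).trans_lt hM'
  obtain ⟨N, hN⟩ := eventually_atTop.1 hfr
  have hne : ∀ n, f n ≠ 0 := fun n hn => by
    exact hN (max n N) (le_max_right _ _) ((hzero n hn _ (le_max_left _ _)).trans_le zero_le)
  -- The range goes up to `N + 1` so that the minimum is over a non-empty set.
  have hpos : 0 < min M' ((Finset.range (N + 1)).inf' ⟨0, by simp⟩ f) := by
    refine lt_min hM'0 ((Finset.lt_inf'_iff _).2 fun n _ => pos_iff_ne_zero.2 (hne n))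
  obtain ⟨n, hn⟩ := (hp.eventually (gt_mem_nhds hpos)).exists
  rcases lt_or_ge (p n) N with h | h
  · exact absurd (Finset.inf'_le f (Finset.mem_range.2 (h.trans (Nat.lt_succ_self N))))
      (not_le.2 (hn.trans_le (min_le_right _ _)))
  · exact hN _ h (hn.le.trans (min_le_left _ _))

/-! ### Implications between the notions of chaos in a metric space. -/

section Chaos

variable {X : Type*} [MetricSpace X]

theorem edist_iterate_limits {f : X → X} {p q : ℕ → ℕ} {x y : X}
    (hp : Tendsto (fun n => dist (f^[p n] x) (f^[p n] y)) atTop (𝓝 0))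
    (hq : Tendsto (fun n => dist (f^[q n] x) (f^[q n] y)) atTop atTop) :
    liminf (fun n : ℕ => edist (f^[n] x) (f^[n] y)) atTop = 0 ∧
      limsup (fun n : ℕ => edist (f^[n] x) (f^[n] y)) atTop = ∞ := by
  constructor
  · refine liminf_eq_zero_of_tendsto_comp (p := p) (fun n hn => ?_) ?_
    · rw [Function.iterate_succ_apply', Function.iterate_succ_apply', edist_eq_zero.1 hn,
        edist_self]
    · simpa [Function.comp_def, edist_dist] using ENNReal.tendsto_ofReal hp
  · refine limsup_eq_top_of_tendsto_comp (q := q) (fun n => edist_ne_top _ _) ?_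
    simpa [Function.comp_def, edist_dist] using ENNReal.tendsto_ofReal_nhds_top.2 hq

theorem IsUniformlyLiYorkeScrambled.isLiYorkeScrambled {f : X → X} {S : Set X}
    (h : IsUniformlyLiYorkeScrambled f S) : IsLiYorkeScrambled f S := by
  obtain ⟨hS, p, q, hpq⟩ := h
  refine ⟨hS, fun x hx y hy hxy => ?_⟩
  obtain ⟨h0, h1⟩ := edist_iterate_limits (hpq x hx y hy hxy).1 (hpq x hx y hy hxy).2
  exact ⟨h0, h1 ▸ ENNReal.zero_lt_top⟩

theorem IsDenselyUniformlyLiYorkeChaotic.isLiYorkeChaotic {f : X → X}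
    (h : IsDenselyUniformlyLiYorkeChaotic f) : IsLiYorkeChaotic f := by
  obtain ⟨S, -, hS, hf⟩ := h
  exact ⟨S, hS, hf.isLiYorkeScrambled⟩

theorem IsLiYorkeChaotic.exists_pair {f : X → X} (h : IsLiYorkeChaotic f) :
    ∃ x y, IsLiYorkePair f x y := by
  obtain ⟨S, -, ⟨x, hx, y, hy, hxy⟩, hS⟩ := h
  exact ⟨x, y, hS x hx y hy hxy⟩

end Chaos

/-! ### Bounded operators: power boundedness and irregular subspaces. -/

section Irregular

variable {𝕜 X : Type*} [RCLike 𝕜] [NormedAddCommGroup X] [NormedSpace 𝕜 X]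

theorem edist_iterate_eq_enorm (T : X →L[𝕜] X) (n : ℕ) (x y : X) :
    edist (T^[n] x) (T^[n] y) = ‖(T ^ n) (x - y)‖ₑ := by
  rw [← FunLike.coe_pow_eq_iterate, edist_eq_enorm_sub, map_sub]

theorem dist_iterate_eq_norm (T : X →L[𝕜] X) (n : ℕ) (x y : X) :
    dist (T^[n] x) (T^[n] y) = ‖(T ^ n) (x - y)‖ := by
  rw [← FunLike.coe_pow_eq_iterate, dist_eq_norm, map_sub]

theorem IsIrregularVector.isLiYorkePair {T : X →L[𝕜] X} {x : X} (h : IsIrregularVector T x) :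
    IsLiYorkePair T x 0 := by
  simp only [IsLiYorkePair, edist_iterate_eq_enorm, sub_zero]
  exact ⟨h.1, h.2 ▸ ENNReal.zero_lt_top⟩

theorem exists_ne_zero_of_dense [Nontrivial X] {Y : Submodule 𝕜 X} (hd : Dense (Y : Set X)) :
    ∃ y ∈ Y, y ≠ 0 := by
  refine Y.exists_mem_ne_zero_of_ne_bot fun h => ?_
  subst h
  obtain ⟨x, hx⟩ := exists_ne (0 : X)
  exact hx (by simpa using hd x)

theorem exists_pair_of_dense_irregularManifold [Nontrivial X] {T : X →L[𝕜] X}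
    {Y : Submodule 𝕜 X} (hd : Dense (Y : Set X)) (hY : IsIrregularManifold T Y) :
    ∃ x y, IsLiYorkePair T x y := by
  obtain ⟨y, hy, hy0⟩ := exists_ne_zero_of_dense hd
  exact ⟨y, 0, (hY y hy hy0).isLiYorkePair⟩

theorem no_pair_of_powerBounded {T : X →L[𝕜] X} {M : ℝ} (hM : ∀ n x, ‖(T ^ n) x‖ ≤ M * ‖x‖)
    (x y : X) : ¬ IsLiYorkePair T x y := by
  simp only [IsLiYorkePair, edist_iterate_eq_enorm]
  rintro ⟨h0, h1⟩
  have hM' : ∀ m n, m ≤ n → ‖(T ^ n) (x - y)‖ₑ ≤ ENNReal.ofReal M * ‖(T ^ m) (x - y)‖ₑ := by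
    intro m n hmn
    obtain ⟨d, rfl⟩ := Nat.exists_eq_add_of_le' hmn
    rw [pow_add, mul_apply_eq_comp, ← ofReal_norm, ← ofReal_norm,
      ← ENNReal.ofReal_mul' (norm_nonneg _)]
    exact ENNReal.ofReal_le_ofReal (hM _ _)
  refine h1.ne' (le_antisymm (ENNReal.le_of_forall_pos_le_add fun ε hε _ => ?_) zero_le)
  rw [zero_add]
  -- Once the orbit is below this threshold, the power bound keeps it below `ε`; the `+ 1` avoids a
  -- zero denominator.
  have hδ : 0 < (ε : ℝ≥0∞) / (ENNReal.ofReal M + 1) :=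
    ENNReal.div_pos (ENNReal.coe_pos.2 hε).ne' (by simp)
  obtain ⟨m, hm⟩ := (frequently_lt_of_liminf_lt (by isBoundedDefault) (h0.trans_lt hδ)).exists
  refine limsup_le_of_le (by isBoundedDefault) ?_
  filter_upwards [eventually_ge_atTop m] with n hn
  calc _ ≤ ENNReal.ofReal M * ‖(T ^ m) (x - y)‖ₑ := hM' m n hn
    _ ≤ (ENNReal.ofReal M + 1) * ((ε : ℝ≥0∞) / (ENNReal.ofReal M + 1)) := by
      gcongr
      exact le_self_add
    _ ≤ ε := ENNReal.mul_div_le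

/-- A dense subspace whose non-zero vectors tend to zero along common times `p` and to infinity
along common times `q`. -/
theorem chaotic_of_uniform [Nontrivial X] {T : X →L[𝕜] X} {Y : Submodule 𝕜 X}
    (hd : Dense (Y : Set X)) (p q : ℕ → ℕ)
    (hp : ∀ y ∈ Y, Tendsto (fun n => ‖(T ^ p n) y‖) atTop (𝓝 0))
    (hq : ∀ y ∈ Y, y ≠ 0 → Tendsto (fun n => ‖(T ^ q n) y‖) atTop atTop) :
    IsIrregularManifold T Y ∧ IsDenselyUniformlyLiYorkeChaotic T := by
  obtain ⟨z, hz, hz0⟩ := exists_ne_zero_of_dense hd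
  refine ⟨fun y hy hy0 => ?_, Y, hd, fun hY => ?_, ⟨z, hz, 0, Y.zero_mem, hz0⟩, p, q, ?_⟩
  · have := edist_iterate_limits (f := T) (x := y) (y := 0) (p := p) (q := q)
    simp only [dist_iterate_eq_norm, edist_iterate_eq_enorm, sub_zero] at this
    exact this (hp y hy) (hq y hy hy0)
  -- The real multiples of `z` already form an uncountable subset.
  · have hinj : Function.Injective fun r : ℝ => (r : 𝕜) • z :=
      (smul_left_injective 𝕜 hz0).comp RCLike.ofReal_injective
    refine Set.not_countable_univ (α := ℝ) ((hY.preimage hinj).mono fun r _ => ?_)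
    exact Y.smul_mem _ hz
  · intro x hx y hy hxy
    simp only [dist_iterate_eq_norm]
    exact ⟨hp _ (Y.sub_mem hx hy), hq _ (Y.sub_mem hx hy) (sub_ne_zero.2 hxy)⟩

end Irregular

/-! Iterates of a weighted shift -/

section Weights

theorem coe_iterate_succ (n : ℕ) (i : ℕ+) : (((· + 1)^[n] i : ℕ+) : ℕ) = i + n := by
  induction n with
  | zero => rfl
  | succ n ih => rw [Function.iterate_succ_apply', PNat.add_coe, ih, PNat.one_coe, add_assoc]

variable {𝕜 : Type*} [RCLike 𝕜]

/-- The product of the `n` weights that follow position `i`. -/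
noncomputable def iterWeight (w : ℕ+ → 𝕜) (n : ℕ) (i : ℕ+) : 𝕜 :=
  ∏ j ∈ Finset.range n, w ((· + 1)^[j + 1] i)

theorem shiftSeq_iterate (w : ℕ+ → 𝕜) (n : ℕ) (x : ℕ+ → 𝕜) (i : ℕ+) :
    (shiftSeq w)^[n] x i = iterWeight w n i * x ((· + 1)^[n] i) := by
  induction n generalizing x with
  | zero => simp [iterWeight]
  | succ n ih =>
    rw [Function.iterate_succ_apply, ih, iterWeight, iterWeight, Finset.prod_range_succ, shiftSeq,
      Function.iterate_succ_apply', mul_assoc]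

/-- The interval has `n + 1` elements, so the supremum in condition 1 sees only products of at least
two weights. -/
theorem prod_Icc_enorm_eq (w : ℕ+ → 𝕜) (k n : ℕ+) :
    ∏ j ∈ Finset.Icc (k + 1) (n + k + 1), ‖w j‖ₑ = ‖iterWeight w (n + 1) k‖ₑ := by
  have h : ‖iterWeight w (n + 1) k‖ₑ
      = ∏ j ∈ Finset.range ((n : ℕ) + 1), ‖w ((· + 1)^[j + 1] k)‖ₑ := by
    rw [← ofReal_norm, iterWeight, norm_prod, ENNReal.ofReal_prod_of_nonneg (by simp)]
    simp
  rw [h]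
  symm
  refine Finset.prod_nbij (fun j => (· + 1)^[j + 1] k) ?_ ?_ ?_ (fun _ _ => rfl)
  · intro j hj
    rw [Finset.mem_range] at hj
    simp only [Finset.mem_Icc, ← PNat.coe_le_coe, coe_iterate_succ, PNat.add_coe, PNat.one_coe]
    omega
  · intro a _ b _ hab
    have := congrArg PNat.val hab
    simp only [coe_iterate_succ] at this
    omega
  · intro j hj
    simp only [Finset.coe_Icc, Set.mem_Icc, ← PNat.coe_le_coe, PNat.add_coe, PNat.one_coe] at hj
    refine ⟨(j : ℕ) - k - 1, by simp; omega, PNat.eq ?_⟩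
    rw [coe_iterate_succ]
    omega

theorem norm_iterWeight_le {w : ℕ+ → 𝕜} {C : ℝ} (hC : ∀ j, ‖w j‖ ≤ C) (n : ℕ) (i : ℕ+) :
    ‖iterWeight w n i‖ ≤ C ^ n := by
  rw [iterWeight, norm_prod]
  refine (Finset.prod_le_prod (fun _ _ => norm_nonneg _) fun _ _ => hC _).trans ?_
  simp

/-- Bounded products of at least two consecutive weights `w 2, w 3, …` bound all of them. -/
theorem exists_iterWeight_bound {w : ℕ+ → 𝕜} (hw : BddAbove (Set.range fun j => ‖w j‖))
    (h : (⨆ (k : ℕ+) (n : ℕ+), ∏ j ∈ Finset.Icc (k + 1) (n + k + 1), ‖w j‖ₑ) ≠ ∞) :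
    ∃ M : ℝ, 0 ≤ M ∧ ∀ n i, ‖iterWeight w n i‖ ≤ M := by
  obtain ⟨C, hC0, hC⟩ := exists_weight_bound hw
  set S := ⨆ (k : ℕ+) (n : ℕ+), ∏ j ∈ Finset.Icc (k + 1) (n + k + 1), ‖w j‖ₑ with hS
  -- The terms `1` and `C` cover the products of zero and one weight, which `S` does not see.
  refine ⟨1 + C + S.toReal, by positivity, fun n i => ?_⟩
  match n with
  | 0 =>
    have := norm_iterWeight_le hC 0 i
    rw [pow_zero] at this
    linarith [ENNReal.toReal_nonneg (a := S)]
  | 1 =>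
    have := norm_iterWeight_le hC 1 i
    rw [pow_one] at this
    linarith [ENNReal.toReal_nonneg (a := S)]
  | n + 2 =>
    have h1 : ‖iterWeight w (n + 2) i‖ₑ ≤ S := by
      have := prod_Icc_enorm_eq w i n.succPNat
      rw [Nat.succPNat_coe] at this
      exact this ▸ le_iSup₂ (f := fun k n : ℕ+ =>
        ∏ j ∈ Finset.Icc (k + 1) (n + k + 1), ‖w j‖ₑ) i n.succPNat
    have h2 := ENNReal.toReal_mono h h1
    rw [toReal_enorm] at h2
    linarith

/-- Unbounded products of weights contain large products ending arbitrarily far out. -/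
theorem exists_large_iterWeight {w : ℕ+ → 𝕜} (hw : BddAbove (Set.range fun j => ‖w j‖))
    (h : (⨆ (k : ℕ+) (n : ℕ+), ∏ j ∈ Finset.Icc (k + 1) (n + k + 1), ‖w j‖ₑ) = ∞) (R : ℝ)
    (N : ℕ+) : ∃ n i, N < (· + 1)^[n] i ∧ R ≤ ‖iterWeight w n i‖ := by
  obtain ⟨C, hC0, hC⟩ := exists_weight_bound hw
  -- A product exceeding `(C + 1) ^ N` has more than `N` factors, hence ends beyond `N`.
  have hlt : ENNReal.ofReal (max R ((C + 1) ^ (N : ℕ))) < ⊤ := ENNReal.ofReal_lt_top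
  rw [← h] at hlt
  obtain ⟨k, hk⟩ := lt_iSup_iff.1 hlt
  obtain ⟨n, hn⟩ := lt_iSup_iff.1 hk
  rw [prod_Icc_enorm_eq, ← ofReal_norm, ENNReal.ofReal_lt_ofReal_iff_of_nonneg (by positivity),
    max_lt_iff] at hn
  refine ⟨n + 1, k, ?_, hn.1.le⟩
  have h1 : (C + 1) ^ (N : ℕ) < (C + 1) ^ ((n : ℕ) + 1) :=
    hn.2.trans_le (norm_iterWeight_le (fun j => (hC j).trans (by linarith)) _ _)
  have h2 : (N : ℕ) < n + 1 :=
    lt_of_not_ge fun hle => h1.not_ge (pow_le_pow_right₀ (by linarith) hle)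
  rw [← PNat.coe_lt_coe, coe_iterate_succ]
  omega

end Weights

/-! Sequence spaces with a solid norm, and the spikes that produce irregular vectors -/

open Polynomial in
-- Divide out the zero at the origin: the cofactor is non-zero there and, by continuity, keeps half
-- its modulus nearby.
theorem Polynomial.exists_pow_le_norm_eval {𝕜 : Type*} [RCLike 𝕜] {P : 𝕜[X]} (hP : P ≠ 0) :
    ∃ (m : ℕ) (δ : ℝ), 0 < δ ∧ ∀ᶠ z in 𝓝 (0 : 𝕜), δ * ‖z‖ ^ m ≤ ‖P.eval z‖ := by
  obtain ⟨Q, hPQ, hQ⟩ := P.exists_eq_pow_rootMultiplicity_mul_and_not_dvd hP 0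
  rw [dvd_iff_isRoot, IsRoot.def] at hQ
  have hQ' : 0 < ‖Q.eval 0‖ := norm_pos_iff.2 hQ
  refine ⟨P.rootMultiplicity 0, ‖Q.eval 0‖ / 2, by positivity, ?_⟩
  have hev : ∀ᶠ z in 𝓝 (0 : 𝕜), ‖Q.eval 0‖ / 2 < ‖Q.eval z‖ :=
    Q.continuous.norm.continuousAt.eventually (lt_mem_nhds (half_lt_self hQ'))
  filter_upwards [hev] with z hz
  have : P.eval z = z ^ P.rootMultiplicity 0 * Q.eval z := by
    conv_lhs => rw [hPQ]
    simp
  rw [this, norm_mul, norm_pow, mul_comm]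
  gcongr

open Polynomial in
theorem Polynomial.exists_norm_eval_le {𝕜 : Type*} [RCLike 𝕜] (P : 𝕜[X]) :
    ∃ A : ℝ, 0 ≤ A ∧ ∀ z : 𝕜, ‖z‖ ≤ 1 → ‖P.eval z‖ ≤ A := by
  obtain ⟨A, hA⟩ := (isCompact_closedBall (0 : 𝕜) 1).exists_bound_of_continuousOn
    P.continuous.continuousOn
  have h := fun z (hz : ‖z‖ ≤ 1) => hA z (by simpa using hz)
  exact ⟨A, (norm_nonneg _).trans (h 0 (by simp)), h⟩

/-! ### Weighted shifts on an abstract solid sequence space. -/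

section SequenceSpace

variable {𝕜 E : Type*} [RCLike 𝕜] [NormedAddCommGroup E] [NormedSpace 𝕜 E]

/-- `E` is a space of sequences, with coordinates `π` and unit vectors `e` of dense span, whose
norm is monotone in the moduli of the coordinates, even after forgetting some of them. -/
structure IsSolidSequenceSpace (π : E →ₗ[𝕜] ℕ+ → 𝕜) (e : ℕ+ → E) : Prop where
  coord_unit : ∀ i, π (e i) = Pi.single i 1
  norm_unit_le : ∀ i, ‖e i‖ ≤ 1
  norm_coord_le : ∀ x i, ‖π x i‖ ≤ ‖x‖
  norm_le_of_coord : ∀ (x y : E) (C : ℝ) (σ : ℕ+ → ℕ+), 0 ≤ C → Function.Injective σ →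
    (∀ i, ‖π y i‖ ≤ C * ‖π x (σ i)‖) → ‖y‖ ≤ C * ‖x‖
  dense_span : ∀ x, x ∈ closure (Submodule.span 𝕜 (Set.range e) : Set E)

namespace IsSolidSequenceSpace

variable {π : E →ₗ[𝕜] ℕ+ → 𝕜} {e : ℕ+ → E} {w : ℕ+ → 𝕜} {T : E →L[𝕜] E}

theorem nontrivial (hE : IsSolidSequenceSpace π e) : Nontrivial E := by
  refine ⟨e 1, 0, fun h => ?_⟩
  have := congrFun (hE.coord_unit 1) 1
  simp [h] at this

theorem eq_zero_of_coord (hE : IsSolidSequenceSpace π e) {y : E} (h : ∀ i, π y i = 0) :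
    y = 0 := by
  have := hE.norm_le_of_coord 0 y 0 id le_rfl Function.injective_id (by simp [h])
  simpa using this

theorem coord_pow (hT : ∀ x, π (T x) = shiftSeq w (π x)) (n : ℕ) (x : E) (i : ℕ+) :
    π ((T ^ n) x) i = iterWeight w n i * π x ((· + 1)^[n] i) := by
  have : π ((T ^ n) x) = (shiftSeq w)^[n] (π x) := by
    induction n with
    | zero => simp
    | succ n ih => rw [pow_succ', mul_apply_eq_comp, hT, ih, Function.iterate_succ_apply']
  rw [this, shiftSeq_iterate]

theorem norm_pow_le (hE : IsSolidSequenceSpace π e) (hT : ∀ x, π (T x) = shiftSeq w (π x))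
    {n : ℕ} {M : ℝ} (hM0 : 0 ≤ M) (hM : ∀ i, ‖iterWeight w n i‖ ≤ M) (x : E) :
    ‖(T ^ n) x‖ ≤ M * ‖x‖ := by
  refine hE.norm_le_of_coord _ _ _ _ hM0
    (Function.Injective.iterate (add_left_injective (1 : ℕ+)) n) fun i => ?_
  rw [coord_pow hT, norm_mul]
  exact mul_le_mul_of_nonneg_right (hM i) (norm_nonneg _)

theorem pow_unit_eq_zero (hE : IsSolidSequenceSpace π e)
    (hT : ∀ x, π (T x) = shiftSeq w (π x)) {n : ℕ} {s : ℕ+} (h : (s : ℕ) ≤ n) :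
    (T ^ n) (e s) = 0 := by
  refine hE.eq_zero_of_coord fun i => ?_
  have hne : (· + 1)^[n] i ≠ s := fun his => by
    have := congrArg PNat.val his
    rw [coe_iterate_succ] at this
    have := i.pos
    omega
  rw [coord_pow hT, hE.coord_unit, Pi.single_eq_of_ne hne, mul_zero]

theorem norm_coord_mul_le (hE : IsSolidSequenceSpace π e)
    (hT : ∀ x, π (T x) = shiftSeq w (π x)) (n : ℕ) (x : E) (i : ℕ+) :
    ‖iterWeight w n i‖ * ‖π x ((· + 1)^[n] i)‖ ≤ ‖(T ^ n) x‖ := by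
  rw [← norm_mul, ← coord_pow hT]
  exact hE.norm_coord_le _ _

/-- The coordinate functionals are continuous. -/
noncomputable def coordCLM (hE : IsSolidSequenceSpace π e) (i : ℕ+) : E →L[𝕜] 𝕜 :=
  ((LinearMap.proj i).comp π).mkContinuous 1 fun x => by simpa using hE.norm_coord_le x i

theorem coordCLM_apply (hE : IsSolidSequenceSpace π e) (i : ℕ+) (x : E) :
    hE.coordCLM i x = π x i := rfl

/-- Iterate from `1` the map taking `N` to the end of a large product beyond `N`. The required size
depends on `s k`, not on the new site `s (k + 1)`, so it is fixed before the product is chosen. -/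
theorem exists_spikes (hw : BddAbove (Set.range fun j => ‖w j‖))
    (h : (⨆ (k : ℕ+) (n : ℕ+), ∏ j ∈ Finset.Icc (k + 1) (n + k + 1), ‖w j‖ₑ) = ∞)
    (G : ℕ+ → ℝ) : ∃ (s : ℕ → ℕ+) (q : ℕ → ℕ) (i : ℕ → ℕ+), StrictMono s ∧
      (∀ k, (· + 1)^[q k] (i k) = s (k + 1)) ∧ ∀ k, G (s k) ≤ ‖iterWeight w (q k) (i k)‖ := by
  choose q i hlt hG using fun N => exists_large_iterWeight hw h (G N) N
  let f : ℕ+ → ℕ+ := fun N => (· + 1)^[q N] (i N)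
  let s : ℕ → ℕ+ := fun k => f^[k] 1
  have hs : ∀ k, (· + 1)^[q (s k)] (i (s k)) = s (k + 1) := fun k =>
    (Function.iterate_succ_apply' f k 1).symm
  exact ⟨s, fun k => q (s k), fun k => i (s k),
    strictMono_nat_of_lt_succ fun k => (hlt (s k)).trans_eq (hs k), hs, fun k => hG _⟩

end IsSolidSequenceSpace

end SequenceSpace

/-! ### Vectors made of spikes, and the dense subspace they generate. -/

section Spikes

open Polynomial IsSolidSequenceSpace

variable {𝕜 E : Type*} [RCLike 𝕜] [NormedAddCommGroup E] [NormedSpace 𝕜 E]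
variable {π : E →ₗ[𝕜] ℕ+ → 𝕜} {e : ℕ+ → E} {w : ℕ+ → 𝕜} {T : E →L[𝕜] E}
variable {t : ℕ → 𝕜} {s : ℕ → ℕ+}

theorem norm_spike_le (hE : IsSolidSequenceSpace π e) (ht : ∀ k, ‖t k‖ ≤ (1 / 2) ^ k) {A : ℝ}
    {P : 𝕜[X]} (hA : ∀ k, ‖P.eval (t k)‖ ≤ A) (k : ℕ) :
    ‖(t k * P.eval (t k)) • e (s (k + 1))‖ ≤ A * (1 / 2) ^ k := by
  rw [norm_smul, norm_mul, mul_comm A]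
  have h := mul_le_mul (ht k) (hA k) (norm_nonneg _) (by positivity)
  exact (mul_le_of_le_one_right (by positivity) (hE.norm_unit_le _)).trans h

theorem summable_spike [CompleteSpace E] (hE : IsSolidSequenceSpace π e)
    (ht : ∀ k, ‖t k‖ ≤ (1 / 2) ^ k) (P : 𝕜[X]) :
    Summable fun k => (t k * P.eval (t k)) • e (s (k + 1)) := by
  obtain ⟨A, -, hA⟩ := P.exists_norm_eval_le
  have ht1 : ∀ k, ‖t k‖ ≤ 1 := fun k => (ht k).trans (pow_le_one₀ (by norm_num) (by norm_num))
  exact Summable.of_norm_bounded (summable_geometric_two.mul_left A)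
    (norm_spike_le hE ht fun k => hA _ (ht1 k))

/-- `P ↦ ∑ₖ tₖ P(tₖ) e_{s (k + 1)}`. -/
noncomputable def spikeMap [CompleteSpace E] (hE : IsSolidSequenceSpace π e)
    (ht : ∀ k, ‖t k‖ ≤ (1 / 2) ^ k) (s : ℕ → ℕ+) : 𝕜[X] →ₗ[𝕜] E where
  toFun P := ∑' k, (t k * P.eval (t k)) • e (s (k + 1))
  map_add' P Q := by
    rw [← (summable_spike hE ht P).tsum_add (summable_spike hE ht Q)]
    simp only [eval_add, mul_add, add_smul]
  map_smul' c P := by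
    rw [RingHom.id_apply, ← (summable_spike hE ht P).tsum_const_smul]
    simp only [eval_smul, smul_smul, smul_eq_mul, mul_left_comm]

theorem hasSum_spikeMap [CompleteSpace E] (hE : IsSolidSequenceSpace π e)
    (ht : ∀ k, ‖t k‖ ≤ (1 / 2) ^ k) (P : 𝕜[X]) :
    HasSum (fun k => (t k * P.eval (t k)) • e (s (k + 1))) (spikeMap hE ht s P) :=
  (summable_spike hE ht P).hasSum

theorem norm_spikeMap_le [CompleteSpace E] (hE : IsSolidSequenceSpace π e)
    (ht : ∀ k, ‖t k‖ ≤ (1 / 2) ^ k) {A : ℝ} {P : 𝕜[X]} (hA : ∀ k, ‖P.eval (t k)‖ ≤ A) :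
    ‖spikeMap hE ht s P‖ ≤ A * 2 :=
  tsum_of_norm_bounded (hasSum_geometric_two.mul_left A) (norm_spike_le hE ht hA)

theorem coord_spikeMap [CompleteSpace E] (hE : IsSolidSequenceSpace π e)
    (ht : ∀ k, ‖t k‖ ≤ (1 / 2) ^ k) (hs : StrictMono s) (P : 𝕜[X]) (k : ℕ) :
    π (spikeMap hE ht s P) (s (k + 1)) = t k * P.eval (t k) := by
  have h := (hE.coordCLM (s (k + 1))).hasSum (hasSum_spikeMap (s := s) hE ht P)
  rw [coordCLM_apply] at h
  refine h.unique ?_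
  convert hasSum_single k fun j hj => ?_
  · simp [coordCLM_apply, hE.coord_unit]
  · have : s (k + 1) ≠ s (j + 1) := fun h => hj (by have := hs.injective h; omega)
    simp [coordCLM_apply, hE.coord_unit, this]

/-- Spikes with `k < j` sit at `s (k + 1) ≤ s j` and are annihilated. The others grow by at most `C
^ s j`, which `htC` absorbs with a factor summable in `k` and tending to zero in `j`. -/
theorem tendsto_pow_spikeMap [CompleteSpace E] (hE : IsSolidSequenceSpace π e)
    (hT : ∀ x, π (T x) = shiftSeq w (π x))
    (ht : ∀ k, ‖t k‖ ≤ (1 / 2) ^ k) (hs : StrictMono s) {C : ℝ} (hC0 : 0 ≤ C)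
    (hC : ∀ j, ‖w j‖ ≤ C)
    (htC : ∀ j k, j ≤ k → ‖t k‖ * C ^ (s j : ℕ) ≤ (1 / 2) ^ j * (1 / 2) ^ k) (P : 𝕜[X]) :
    Tendsto (fun j => ‖(T ^ (s j : ℕ)) (spikeMap hE ht s P)‖) atTop (𝓝 0) := by
  obtain ⟨A, hA0, hA⟩ := P.exists_norm_eval_le
  have ht1 : ∀ k, ‖t k‖ ≤ 1 := fun k => (ht k).trans (pow_le_one₀ (by norm_num) (by norm_num))
  have hlim : Tendsto (fun j : ℕ => A * (1 / 2 : ℝ) ^ j * 2) atTop (𝓝 0) := by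
    simpa using ((tendsto_pow_atTop_nhds_zero_of_lt_one (r := (1 / 2 : ℝ)) (by norm_num)
      (by norm_num)).const_mul A).mul_const 2
  refine squeeze_zero (fun _ => norm_nonneg _) (fun j => ?_) hlim
  rw [← ((T ^ (s j : ℕ)).hasSum (hasSum_spikeMap (s := s) hE ht P)).tsum_eq]
  refine tsum_of_norm_bounded (hasSum_geometric_two.mul_left (A * (1 / 2 : ℝ) ^ j)) fun k => ?_
  rw [map_smul]
  rcases lt_or_ge k j with hkj | hjk
  · rw [hE.pow_unit_eq_zero hT (PNat.coe_le_coe _ _ |>.2 (hs.monotone hkj)), smul_zero, norm_zero]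
    positivity
  · have h1 : ‖(T ^ (s j : ℕ)) (e (s (k + 1)))‖ ≤ C ^ (s j : ℕ) :=
      (hE.norm_pow_le hT (by positivity) (norm_iterWeight_le hC _) _).trans
        (mul_le_of_le_one_right (by positivity) (hE.norm_unit_le _))
    rw [norm_smul, norm_mul]
    calc ‖t k‖ * ‖P.eval (t k)‖ * ‖(T ^ (s j : ℕ)) (e (s (k + 1)))‖
        ≤ ‖t k‖ * A * C ^ (s j : ℕ) := by
          gcongr
          exact hA _ (ht1 k)
      _ = A * (‖t k‖ * C ^ (s j : ℕ)) := by ring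
      _ ≤ A * ((1 / 2) ^ j * (1 / 2) ^ k) := by
          exact mul_le_mul_of_nonneg_left (htC j k hjk) hA0
      _ = _ := by ring

/-- `P ↦ ∑ₘ aₘ e_{φ m}`, where `aₘ` are the coefficients of `P` and `φ` is the first component of
the pairing function, so that it takes each value infinitely often. -/
noncomputable def unitMap (𝕜 : Type*) {E : Type*} [RCLike 𝕜] [NormedAddCommGroup E]
    [NormedSpace 𝕜 E] (e : ℕ+ → E) : 𝕜[X] →ₗ[𝕜] E :=
  (Polynomial.basisMonomials 𝕜).constr 𝕜 fun m => e m.unpair.1.succPNat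

theorem unitMap_monomial (e : ℕ+ → E) (m : ℕ) :
    unitMap 𝕜 e (monomial m 1) = e m.unpair.1.succPNat := by
  simpa [unitMap] using (Polynomial.basisMonomials 𝕜).constr_basis 𝕜
    (fun m => e m.unpair.1.succPNat) m

/-- Finite support makes this part invisible at large times and at far coordinates, so only the
spikes matter there. -/
theorem unitMap_eventually (hE : IsSolidSequenceSpace π e)
    (hT : ∀ x, π (T x) = shiftSeq w (π x)) (P : 𝕜[X]) :
    ∃ N : ℕ, (∀ n ≥ N, (T ^ n) (unitMap 𝕜 e P) = 0) ∧
      ∀ i : ℕ+, N ≤ i → π (unitMap 𝕜 e P) i = 0 := by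
  induction P using Polynomial.induction_on' with
  | add P Q hP hQ =>
    obtain ⟨M, hM⟩ := hP
    obtain ⟨N, hN⟩ := hQ
    refine ⟨max M N, fun n hn => ?_, fun i hi => ?_⟩
    · rw [map_add, map_add, hM.1 n (le_of_max_le_left hn), hN.1 n (le_of_max_le_right hn),
        add_zero]
    · rw [map_add, map_add, Pi.add_apply, hM.2 i (le_of_max_le_left hi),
        hN.2 i (le_of_max_le_right hi), add_zero]
  | monomial m a =>
    have h : unitMap 𝕜 e (monomial m a) = a • e m.unpair.1.succPNat := by
      rw [← unitMap_monomial (𝕜 := 𝕜) e m, ← map_smul, smul_monomial, smul_eq_mul, mul_one]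
    refine ⟨m.unpair.1.succPNat + 1, fun n hn => ?_, fun i hi => ?_⟩
    · rw [h, map_smul, hE.pow_unit_eq_zero hT (by omega), smul_zero]
    · have : i ≠ m.unpair.1.succPNat := fun h => by
        rw [h] at hi
        omega
      rw [h, map_smul, hE.coord_unit, Pi.smul_apply, Pi.single_eq_of_ne this, smul_zero]

/-- Along the monomials of degree `Nat.pair i.natPred n` the unit part is constantly `e i`, while
the spike part is at most `2 * (1 / 2) ^ n`. This needs `ht2`, because `ht` only gives `‖t 0‖ ≤ 1`.
-/
theorem dense_range_unitMap_add_spikeMap [CompleteSpace E] (hE : IsSolidSequenceSpace π e)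
    (ht : ∀ k, ‖t k‖ ≤ (1 / 2) ^ k) (ht2 : ∀ k, ‖t k‖ ≤ 1 / 2) :
    Dense (LinearMap.range (unitMap 𝕜 e + spikeMap hE ht s) : Set E) := by
  set Y := LinearMap.range (unitMap 𝕜 e + spikeMap hE ht s)
  have he : ∀ i, e i ∈ Y.topologicalClosure := by
    intro i
    have hlim : Tendsto (fun n => spikeMap hE ht s (monomial (Nat.pair i.natPred n) 1)) atTop
        (𝓝 0) := by
      have h2 : Tendsto (fun n : ℕ => (1 / 2 : ℝ) ^ n * 2) atTop (𝓝 0) := by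
        simpa using (tendsto_pow_atTop_nhds_zero_of_lt_one (r := (1 / 2 : ℝ)) (by norm_num)
          (by norm_num)).mul_const 2
      refine squeeze_zero_norm (fun n => norm_spikeMap_le hE ht fun k => ?_) h2
      rw [eval_monomial, one_mul, norm_pow]
      exact (pow_le_pow_left₀ (norm_nonneg _) (ht2 k) _).trans
        (pow_le_pow_of_le_one (by norm_num) (by norm_num) (Nat.right_le_pair _ _))
    refine mem_closure_of_tendsto (b := atTop)
      (f := fun n => e i + spikeMap hE ht s (monomial (Nat.pair i.natPred n) 1))
      (by simpa using hlim.const_add (e i)) (Eventually.of_forall fun n => ?_)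
    refine ⟨monomial (Nat.pair i.natPred n) 1, ?_⟩
    rw [LinearMap.add_apply, unitMap_monomial, Nat.unpair_pair, PNat.succPNat_natPred]
  have hspan : Submodule.span 𝕜 (Set.range e) ≤ Y.topologicalClosure := by
    rw [Submodule.span_le]
    rintro _ ⟨i, rfl⟩
    exact he i
  exact fun x => closure_minimal hspan Y.isClosed_topologicalClosure (hE.dense_span x)

theorem exists_uniform_manifold [CompleteSpace E] (hE : IsSolidSequenceSpace π e)
    (hT : ∀ x, π (T x) = shiftSeq w (π x)) (hw : BddAbove (Set.range fun j => ‖w j‖))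
    (h : (⨆ (k : ℕ+) (n : ℕ+), ∏ j ∈ Finset.Icc (k + 1) (n + k + 1), ‖w j‖ₑ) = ∞) :
    ∃ (Y : Submodule 𝕜 E) (p q : ℕ → ℕ), Dense (Y : Set E) ∧
      (∀ y ∈ Y, Tendsto (fun n => ‖(T ^ p n) y‖) atTop (𝓝 0)) ∧
      ∀ y ∈ Y, y ≠ 0 → Tendsto (fun n => ‖(T ^ q n) y‖) atTop atTop := by
  obtain ⟨C, hC0, hC⟩ := exists_weight_bound hw
  obtain ⟨s, q, i, hs, hsq, hG⟩ := exists_spikes hw h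
    -- With `N = s k` this is `s k * ‖t k‖⁻¹ ^ s k`: the growing exponent beats every fixed power of
    -- `t k`, and the factor `s k` leaves divergence.
    fun N => (N : ℕ) * ((C + 2) ^ (3 * (N : ℕ))) ^ (N : ℕ)
  have hsk : ∀ k, k < s k := fun k => by
    induction k with
    | zero => exact (s 0).pos
    | succ k ih => exact (Nat.succ_le_of_lt ih).trans_lt (hs k.lt_succ_self)
  have hslim : Tendsto (fun k => (s k : ℕ)) atTop atTop :=
    tendsto_atTop_mono (fun k => (hsk k).le) tendsto_id
  -- Of the exponent `3 * s k`, one `s k` pays for `C ^ s j`; the remaining `2 * s k ≥ j + k` gives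
  -- the geometric decay, as `C + 2 ≥ 2`.
  let t : ℕ → 𝕜 := fun k => (((C + 2) ^ (3 * (s k : ℕ)))⁻¹ : ℝ)
  have htn : ∀ k, ‖t k‖ = ((C + 2) ^ (3 * (s k : ℕ)))⁻¹ := fun k => by
    rw [RCLike.norm_ofReal, abs_of_pos (by positivity)]
  have hinv : ∀ n, ((C + 2) ^ n)⁻¹ ≤ (1 / 2 : ℝ) ^ n := fun n => by
    rw [one_div, inv_pow]
    gcongr
    linarith
  have hhalf : ∀ {m n : ℕ}, m ≤ n → (1 / 2 : ℝ) ^ n ≤ (1 / 2) ^ m := fun h =>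
    pow_le_pow_of_le_one (by norm_num) (by norm_num) h
  have ht : ∀ k, ‖t k‖ ≤ (1 / 2) ^ k := fun k => by
    rw [htn]
    exact (hinv _).trans (hhalf (by have := hsk k; omega))
  have ht2 : ∀ k, ‖t k‖ ≤ 1 / 2 := fun k => by
    rw [htn]
    exact (hinv _).trans ((hhalf (m := 1) (by have := (s k).pos; omega)).trans (by norm_num))
  have htC : ∀ j k, j ≤ k → ‖t k‖ * C ^ (s j : ℕ) ≤ (1 / 2) ^ j * (1 / 2) ^ k := by
    intro j k hjk
    have hjk' : (s j : ℕ) ≤ s k := hs.monotone hjk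
    have h1 : C ^ (s j : ℕ) ≤ (C + 2) ^ (s k : ℕ) :=
      (pow_le_pow_left₀ hC0 (by linarith) _).trans (pow_le_pow_right₀ (by linarith) hjk')
    calc ‖t k‖ * C ^ (s j : ℕ)
        ≤ ((C + 2) ^ (3 * (s k : ℕ)))⁻¹ * (C + 2) ^ (s k : ℕ) := by
          rw [htn]
          gcongr
      _ = ((C + 2) ^ (2 * (s k : ℕ)))⁻¹ := by
          rw [show 3 * (s k : ℕ) = 2 * s k + s k by ring, pow_add]
          field_simp
      _ ≤ (1 / 2) ^ (j + k) := (hinv _).trans (hhalf (by have := hsk k; omega))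
      _ = _ := pow_add _ _ _
  have ht0 : Tendsto t atTop (𝓝 0) := squeeze_zero_norm ht
    (tendsto_pow_atTop_nhds_zero_of_lt_one (by norm_num) (by norm_num))
  refine ⟨LinearMap.range (unitMap 𝕜 e + spikeMap hE ht s), fun k => s k, q,
    dense_range_unitMap_add_spikeMap hE ht ht2, ?_, ?_⟩
  · rintro _ ⟨P, rfl⟩
    obtain ⟨N, hN, -⟩ := unitMap_eventually hE hT P
    refine (tendsto_pow_spikeMap hE hT ht hs hC0 hC htC P).congr' ?_
    filter_upwards [hslim.eventually_ge_atTop N] with k hk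
    rw [LinearMap.add_apply, map_add, hN _ hk, zero_add]
  · rintro _ ⟨P, rfl⟩ hy
    have hP : P ≠ 0 := fun h => hy (by rw [h, map_zero])
    obtain ⟨N, -, hN⟩ := unitMap_eventually hE hT P
    obtain ⟨m, δ, hδ, hm⟩ := Polynomial.exists_pow_le_norm_eval hP
    refine tendsto_atTop_mono' _ ?_
      ((tendsto_natCast_atTop_atTop (R := ℝ)).comp hslim |>.const_mul_atTop hδ)
    filter_upwards [hslim.eventually_ge_atTop N, hslim.eventually_ge_atTop (m + 1),
      ht0.eventually hm] with k hkN hkm hk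
    have hle := hE.norm_coord_mul_le hT (q k) ((unitMap 𝕜 e + spikeMap hE ht s) P) (i k)
    have hsk1 : (s k : ℕ) ≤ s (k + 1) := hs.monotone k.le_succ
    rw [hsq, LinearMap.add_apply, map_add, Pi.add_apply, hN _ (hkN.trans hsk1), zero_add,
      coord_spikeMap hE ht hs, norm_mul] at hle
    refine le_trans ?_ hle
    set B : ℝ := (C + 2) ^ (3 * (s k : ℕ))
    have hB1 : 1 ≤ B := one_le_pow₀ (by linarith)
    have hBk : B ^ (m + 1) ≤ B ^ (s k : ℕ) := pow_le_pow_right₀ hB1 hkm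
    rw [htn] at hk ⊢
    -- Here `B⁻¹ = ‖t k‖`: the spike is at least `δ * B⁻¹ ^ (m + 1)`, and the weight product
    -- supplies `s k * B ^ s k` with `m + 1 ≤ s k`.
    calc δ * (s k : ℕ) = (s k : ℕ) * B ^ (m + 1) * (B⁻¹ * (δ * B⁻¹ ^ m)) := by
          rw [inv_pow]
          field_simp
          ring
      _ ≤ (s k : ℕ) * B ^ (s k : ℕ) * (B⁻¹ * ‖P.eval (t k)‖) := by gcongr
      _ ≤ _ := by
          gcongr
          exact hG k

theorem IsSolidSequenceSpace.tfae_chaos [CompleteSpace E] (hE : IsSolidSequenceSpace π e)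
    (hT : ∀ x, π (T x) = shiftSeq w (π x)) (hw : BddAbove (Set.range fun j => ‖w j‖)) :
    List.TFAE
      [(⨆ (k : ℕ+) (n : ℕ+), ∏ j ∈ Finset.Icc (k + 1) (n + k + 1), ‖w j‖ₑ) = ∞,
        ∃ x y, IsLiYorkePair T x y,
        IsLiYorkeChaotic T,
        ∃ Y : Submodule 𝕜 E, Dense (Y : Set E) ∧ IsIrregularManifold T Y,
        IsDenselyUniformlyLiYorkeChaotic T] := by
  have := hE.nontrivial
  have key (h : (⨆ (k : ℕ+) (n : ℕ+), ∏ j ∈ Finset.Icc (k + 1) (n + k + 1), ‖w j‖ₑ) = ∞) :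
      ∃ Y : Submodule 𝕜 E, Dense (Y : Set E) ∧ IsIrregularManifold T Y ∧
        IsDenselyUniformlyLiYorkeChaotic T := by
    obtain ⟨Y, p, q, hY, hp, hq⟩ := exists_uniform_manifold hE hT hw h
    exact ⟨Y, hY, chaotic_of_uniform hY p q hp hq⟩
  tfae_have 1 → 4 := fun h =>
    let ⟨Y, hY, hI, _⟩ := key h
    ⟨Y, hY, hI⟩
  tfae_have 1 → 5 := fun h =>
    let ⟨_, _, _, hU⟩ := key h
    hU
  tfae_have 4 → 2 := fun ⟨_, hY, hI⟩ => exists_pair_of_dense_irregularManifold hY hI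
  tfae_have 5 → 3 := fun h => h.isLiYorkeChaotic
  tfae_have 3 → 2 := fun h => h.exists_pair
  tfae_have 2 → 1 := by
    rintro ⟨x, y, hxy⟩
    by_contra h
    obtain ⟨M, hM0, hM⟩ := exists_iterWeight_bound hw h
    exact no_pair_of_powerBounded (fun n => hE.norm_pow_le hT hM0 (hM n)) x y hxy
  tfae_finish

end Spikes

/-! The spaces `ℓ^p` and `c₀` -/

section Models

variable {𝕜 : Type*} [RCLike 𝕜]

/-- The coordinates of an element of `ℓ^p`. -/
def lpCoord (𝕜 : Type*) [RCLike 𝕜] (p : ℝ≥0∞) : lp (fun _ : ℕ+ => 𝕜) p →ₗ[𝕜] ℕ+ → 𝕜 where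
  toFun x := x
  map_add' _ _ := rfl
  map_smul' _ _ := rfl

/-- Solidity compares sums of `p`-th powers, where injectivity of `σ` prevents double counting;
density uses convergence of the unit vector expansion for finite `p`. -/
theorem isSolidSequenceSpace_lp (p : ℝ≥0∞) [Fact (1 ≤ p)] (hp : p ≠ ∞) :
    IsSolidSequenceSpace (lpCoord 𝕜 p) fun i => lp.single p i (1 : 𝕜) := by
  have hp0 : p ≠ 0 := (zero_lt_one.trans_le (Fact.out : 1 ≤ p)).ne'
  have hpr : 0 < p.toReal := ENNReal.toReal_pos hp0 hp
  refine ⟨fun i => rfl, fun i => ?_, fun x i => lp.norm_apply_le_norm hp0 x i, ?_, fun x => ?_⟩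
  · rw [lp.norm_single (zero_lt_one.trans_le (Fact.out : 1 ≤ p)), norm_one]
  · intro x y C σ hC hσ h
    refine lp.norm_le_of_tsum_le hpr (by positivity) ?_
    have hx := (lp.memℓp x).summable hpr
    have hle : ∀ i, ‖y i‖ ^ p.toReal ≤ C ^ p.toReal * ‖x (σ i)‖ ^ p.toReal := fun i => by
      rw [← Real.mul_rpow hC (norm_nonneg _)]
      exact Real.rpow_le_rpow (norm_nonneg _) (h i) hpr.le
    rw [Real.mul_rpow hC (norm_nonneg _), lp.norm_rpow_eq_tsum hpr x]
    refine (((lp.memℓp y).summable hpr).tsum_le_tsum hle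
      ((hx.comp_injective hσ).mul_left _)).trans ?_
    rw [tsum_mul_left]
    exact mul_le_mul_of_nonneg_left (tsum_comp_le_tsum_of_inj hx
      (fun i => Real.rpow_nonneg (norm_nonneg _) _) hσ) (by positivity)
  · refine mem_closure_of_tendsto (lp.hasSum_single hp x) (Eventually.of_forall fun F => ?_)
    refine Submodule.sum_mem _ fun i _ => ?_
    have : lp.single p i (x i) = x i • lp.single (E := fun _ : ℕ+ => 𝕜) p i 1 := by
      rw [← lp.single_smul, smul_eq_mul, mul_one]
    rw [this]
    exact Submodule.smul_mem _ _ (Submodule.subset_span ⟨i, rfl⟩)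

/-- The coordinates of an element of `c₀`. -/
def c0Coord (𝕜 : Type*) [RCLike 𝕜] : C₀(ℕ+, 𝕜) →ₗ[𝕜] ℕ+ → 𝕜 where
  toFun x := x
  map_add' _ _ := rfl
  map_smul' _ _ := rfl

/-- The unit vectors of `c₀`. -/
noncomputable def c0Unit (𝕜 : Type*) [RCLike 𝕜] (i : ℕ+) : C₀(ℕ+, 𝕜) where
  toFun := (Pi.single i 1 : ℕ+ → 𝕜)
  continuous_toFun := continuous_of_discreteTopology
  zero_at_infty' := by
    rw [cocompact_eq_cofinite]
    refine tendsto_const_nhds.congr' ?_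
    filter_upwards [(Set.finite_singleton i).compl_mem_cofinite] with j hj
    exact (Pi.single_eq_of_ne (M := fun _ : ℕ+ => 𝕜) hj 1).symm

theorem c0_norm_le {x : C₀(ℕ+, 𝕜)} {C : ℝ} (hC : 0 ≤ C) : ‖x‖ ≤ C ↔ ∀ i, ‖x i‖ ≤ C := by
  rw [← ZeroAtInftyContinuousMap.norm_toBCF_eq_norm, BoundedContinuousFunction.norm_le hC]
  rfl

theorem isSolidSequenceSpace_c0 : IsSolidSequenceSpace (c0Coord 𝕜) (c0Unit 𝕜) := by
  have hcoord : ∀ (x : C₀(ℕ+, 𝕜)) i, ‖x i‖ ≤ ‖x‖ := fun x => (c0_norm_le (norm_nonneg _)).1 le_rfl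
  refine ⟨fun i => rfl, fun i => (c0_norm_le zero_le_one).2 fun j => ?_, hcoord, ?_, fun x => ?_⟩
  · change ‖(Pi.single i 1 : ℕ+ → 𝕜) j‖ ≤ 1
    rcases eq_or_ne j i with rfl | h
    · simp
    · simp [h]
  · intro x y C σ hC _ h
    exact (c0_norm_le (by positivity)).2 fun i =>
      (h i).trans (mul_le_mul_of_nonneg_left (hcoord x _) hC)
  · refine Metric.mem_closure_iff.2 fun ε hε => ?_
    have hx := zero_at_infty x
    rw [cocompact_eq_cofinite] at hx
    -- Truncating `x` to this finite set leaves an error of at most `ε / 2`.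
    have hfin : {i | ¬ ‖x i‖ < ε / 2}.Finite := by
      exact eventually_cofinite.1
        (hx.norm.eventually (gt_mem_nhds (by simpa using hε : ‖(0 : 𝕜)‖ < ε / 2)))
    refine ⟨∑ i ∈ hfin.toFinset, x i • c0Unit 𝕜 i, Submodule.sum_mem _ fun i _ =>
      Submodule.smul_mem _ _ (Submodule.subset_span ⟨i, rfl⟩), ?_⟩
    rw [dist_eq_norm]
    refine lt_of_le_of_lt ((c0_norm_le (by positivity)).2 fun j => ?_) (half_lt_self hε)
    have hj : c0Coord 𝕜 (∑ i ∈ hfin.toFinset, x i • c0Unit 𝕜 i) j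
        = if j ∈ hfin.toFinset then x j else 0 := by
      rw [map_sum, Finset.sum_apply, ← Finset.sum_ite_eq]
      refine Finset.sum_congr rfl fun i _ => ?_
      change x i * (Pi.single i 1 : ℕ+ → 𝕜) j = _
      rcases eq_or_ne j i with rfl | h
      · simp
      · simp [h]
    change ‖x j - c0Coord 𝕜 (∑ i ∈ hfin.toFinset, x i • c0Unit 𝕜 i) j‖ ≤ _
    rw [hj]
    split_ifs with h
    · simpa using (half_pos hε).le
    · rw [sub_zero]
      simpa using (by simpa using h : ‖x j‖ < ε / 2).le

end Models

theorem mainTheorem5 {𝕜 : Type*} [RCLike 𝕜] (w : ℕ+ → 𝕜) (hw0 : ∀ j, w j ≠ 0)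
    (hw : BddAbove (Set.range fun j => ‖w j‖)) :
    (∀ (p : ℝ≥0∞) [Fact (1 ≤ p)], p ≠ ∞ →
      List.TFAE
        [(⨆ (k : ℕ+) (n : ℕ+), ∏ j ∈ Finset.Icc (k + 1) (n + k + 1), ‖w j‖ₑ) = ∞,
          ∃ x y, IsLiYorkePair (shiftLp p w hw) x y,
          IsLiYorkeChaotic (shiftLp p w hw),
          ∃ Y : Submodule 𝕜 (lp (fun _ : ℕ+ => 𝕜) p),
            Dense (Y : Set (lp (fun _ : ℕ+ => 𝕜) p)) ∧ IsIrregularManifold (shiftLp p w hw) Y,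
          IsDenselyUniformlyLiYorkeChaotic (shiftLp p w hw)]) ∧
    List.TFAE
      [(⨆ (k : ℕ+) (n : ℕ+), ∏ j ∈ Finset.Icc (k + 1) (n + k + 1), ‖w j‖ₑ) = ∞,
        ∃ x y, IsLiYorkePair (shiftC0 w hw) x y,
        IsLiYorkeChaotic (shiftC0 w hw),
        ∃ Y : Submodule 𝕜 C₀(ℕ+, 𝕜),
          Dense (Y : Set C₀(ℕ+, 𝕜)) ∧ IsIrregularManifold (shiftC0 w hw) Y,
        IsDenselyUniformlyLiYorkeChaotic (shiftC0 w hw)] := by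
  exact ⟨fun p _ hp => (isSolidSequenceSpace_lp p hp).tfae_chaos (T := shiftLp p w hw)
    (fun _ => rfl) hw, isSolidSequenceSpace_c0.tfae_chaos (T := shiftC0 w hw) (fun _ => rfl) hw⟩
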